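/- Let $k\ge 3$. Let $C^*(\mathbb Z_k*\mathbb Z_2)$ be the full group C$^*$-algebra of the free product, let $w$ and $v$ be the canonical unitaries coming from the generators of $\mathbb Z_k$ and $\mathbb Z_2$ (so $w^k=v^2=1$), and let $$\mathrm{NCP}(k)=\mathrm{Span}\{1,w,w^2,\dots,w^{k-1},v\}\subseteq C^*(\mathbb Z_k*\mathbb Z_2).$$ Its dual space $\mathrm{NCP}(k)^\delta$ carries the involution $f^*(x)=\overline{f(x^*)}$ and the matrix ordering in which $[f_{ij}]_{i,j=1}^q$ is positive if and only if the map $x\mapsto[f_{ij}(x)]_{i,j=1}^q$ from $\mathrm{NCP}(k)$ to $M_q(\mathbb C)$ is completely positive. Let $$\mathcal S_{k,2}=\{(z_1,\dots,z_{k+2})\in\mathbb C^{k+2} : z_1+\cdots+z_k=z_{k+1}+z_{k+2}\},$$ with the involution and the matrix ordering induced by the C$^*$-algebra $\mathbb C^{k+2}$. Then there is a complete order isomorphism $\Phi:\mathrm{NCP}(k)^\delta\to\mathcal S_{k,2}$ (a linear bijection such that, for every $n$, a matrix in $M_n(\mathrm{NCP}(k)^\delta)$ is positive if and only if its entrywise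 image in $M_n(\mathcal S_{k,2})$ is positive) such that: 1. for every faithful state $\mu$ on $\mathrm{NCP}(k)$, $\mathrm{NCP}(k)^\delta$ with order unit $\mu$ is an operator system (a matrix-ordered $*$-vector space with Archimedean matrix order unit $\mu$), and so is $\mathcal S_{k,2}$ with order unit $\Phi(\mu)$; thus $\Phi$ is a unital complete order isomorphism of operator systems for these units; 2. the functional $\tau$ on $\mathrm{NCP}(k)$ determined by $\tau(1)=1$, $\tau(w^j)=0$ for $1\le j\le k-1$ and $\tau(v)=0$ is a faithful state, and $$\Phi(\tau)=\bigl(\tfrac1k,\dots,\tfrac1k,\tfrac12,\tfrac12\bigr).$$ In particular, $\mathrm{NCP}(k)^\delta$ with order unit $\tau$ is unitally completely order isomorphic to $\mathcal S_{k,2}$ with order unit $(\frac1k,\dots,\frac1k,\frac12,\frac12)$. -/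

import Mathlib

open scoped ComplexOrder ENNReal

noncomputable section

universe u

/-! ### The full group C⋆-algebra -/

/-- A unitary representation of a (discrete) group `G` on a nonzero complex Hilbert space. -/
structure UnitaryRep (G : Type u) [Group G] : Type (u + 1) where
  /-- the Hilbert space -/
  H : Type u
  [normed : NormedAddCommGroup H]
  [inner : InnerProductSpace ℂ H]
  [complete : CompleteSpace H]
  [nontrivial : Nontrivial H]
  /-- the action by unitary operators -/
  hom : G →* unitary (H →L[ℂ] H)

attribute [instance] UnitaryRep.normed UnitaryRep.inner UnitaryRep.complete UnitaryRep.nontrivial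

/-- The bounded operators on the space of a unitary representation. -/
abbrev UnitaryRep.Op {G : Type u} [Group G] (π : UnitaryRep G) : Type u := π.H →L[ℂ] π.H

/-- The C⋆-algebra of all uniformly bounded families of operators, indexed by all unitary
representations of `G`, with the supremum norm. -/
abbrev RepProduct (G : Type u) [Group G] : Type (u + 1) :=
  lp (fun π : UnitaryRep G => π.Op) ∞

instance RepProduct.instCStarAlgebra (G : Type u) [Group G] : CStarAlgebra (RepProduct G) where

/-- The universal unitary representation `g ↦ (π g)_π`. -/
def universalRep (G : Type u) [Group G] (g : G) : RepProduct G :=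
  ⟨fun π => (π.hom g : π.Op), memℓp_infty ⟨1, by
    rintro _ ⟨π, rfl⟩
    exact (CStarRing.norm_coe_unitary (π.hom g)).le⟩⟩

/-- The full group C⋆-algebra `C⋆(G)` as a closed star subalgebra: the closed star subalgebra
generated by the image of the universal unitary representation.  Equivalently, it is the completion
of the group algebra `ℂ[G]` in the norm `‖x‖ = sup_π ‖π x‖`. -/
def groupCStarSubalgebra (G : Type u) [Group G] : StarSubalgebra ℂ (RepProduct G) :=
  (StarAlgebra.adjoin ℂ (Set.range (universalRep G))).topologicalClosure

/-- The full group C⋆-algebra `C⋆(G)`. -/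
abbrev GroupCStar (G : Type u) [Group G] : Type (u + 1) := groupCStarSubalgebra G

instance GroupCStar.instCStarAlgebra (G : Type u) [Group G] : CStarAlgebra (GroupCStar G) :=
  StarSubalgebra.cstarAlgebra _ (h_closed := StarSubalgebra.isClosed_topologicalClosure _)

/-- The canonical unitary of `C⋆(G)` attached to a group element. -/
def GroupCStar.of {G : Type u} [Group G] (g : G) : GroupCStar G :=
  ⟨universalRep G g, StarSubalgebra.le_topologicalClosure _
    (StarAlgebra.subset_adjoin ℂ _ ⟨g, rfl⟩)⟩

theorem GroupCStar.of_one {G : Type u} [Group G] : GroupCStar.of (1 : G) = 1 := by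
  apply Subtype.ext
  apply Subtype.ext
  funext π
  simp [GroupCStar.of, universalRep, lp.infty_coeFn_one]

theorem GroupCStar.of_mul {G : Type u} [Group G] (g h : G) :
    GroupCStar.of (g * h) = GroupCStar.of g * GroupCStar.of h := by
  apply Subtype.ext
  apply Subtype.ext
  funext π
  simp [GroupCStar.of, universalRep, lp.infty_coeFn_mul]

theorem GroupCStar.of_pow {G : Type u} [Group G] (g : G) (n : ℕ) :
    GroupCStar.of (g ^ n) = GroupCStar.of g ^ n := by
  induction n with
  | zero => simp [GroupCStar.of_one]
  | succ n ih => rw [pow_succ, pow_succ, GroupCStar.of_mul, ih]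

theorem GroupCStar.star_of {G : Type u} [Group G] (g : G) :
    star (GroupCStar.of g) = GroupCStar.of g⁻¹ := by
  apply Subtype.ext
  apply Subtype.ext
  funext π
  simp only [GroupCStar.of, universalRep, map_inv]
  rfl

/-! ### Matrix-ordered spaces and operator systems -/

/-- A family of sets of square matrices over `V`, one for each size: the data of a matrix
ordering. -/
class MatrixCones (V : Type*) where
  /-- the set of positive `n × n` matrices -/
  cone : (n : ℕ) → Set (Matrix (Fin n) (Fin n) V)

/-- `α⋆ X α` for a scalar matrix `α` and a matrix `X` of vectors. -/
def Matrix.compress {V : Type*} [AddCommGroup V] [Module ℂ V] {n m : ℕ}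
    (α : Matrix (Fin n) (Fin m) ℂ) (X : Matrix (Fin n) (Fin n) V) : Matrix (Fin m) (Fin m) V :=
  Matrix.of fun i j => ∑ a, ∑ b, (star (α a i) * α b j) • X a b

/-- An (abstract) operator system in the sense of Choi and Effros: a matrix-ordered `⋆`-vector
space `V` together with an Archimedean matrix order unit `e`. -/
structure IsOperatorSystem {V : Type*} [AddCommGroup V] [Module ℂ V] [StarAddMonoid V]
    [StarModule ℂ V] [MatrixCones V] (e : V) : Prop where
  isHermitian : ∀ (n : ℕ), ∀ X ∈ MatrixCones.cone (V := V) n, X.IsHermitian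
  add_mem : ∀ (n : ℕ), ∀ X ∈ MatrixCones.cone (V := V) n, ∀ Y ∈ MatrixCones.cone (V := V) n,
    X + Y ∈ MatrixCones.cone (V := V) n
  smul_mem : ∀ (n : ℕ) (r : ℝ), 0 ≤ r → ∀ X ∈ MatrixCones.cone (V := V) n,
    (r : ℂ) • X ∈ MatrixCones.cone (V := V) n
  eq_zero : ∀ (n : ℕ), ∀ X ∈ MatrixCones.cone (V := V) n, -X ∈ MatrixCones.cone (V := V) n → X = 0
  compress_mem : ∀ (n m : ℕ) (α : Matrix (Fin n) (Fin m) ℂ), ∀ X ∈ MatrixCones.cone (V := V) n,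
    Matrix.compress α X ∈ MatrixCones.cone (V := V) m
  star_unit : star e = e
  order_unit : ∀ (n : ℕ) (X : Matrix (Fin n) (Fin n) V), X.IsHermitian →
    ∃ r : ℝ, 0 < r ∧ (r : ℂ) • Matrix.diagonal (fun _ => e) + X ∈ MatrixCones.cone (V := V) n
  archimedean : ∀ (n : ℕ) (X : Matrix (Fin n) (Fin n) V), X.IsHermitian →
    (∀ r : ℝ, 0 < r →
      (r : ℂ) • Matrix.diagonal (fun _ => e) + X ∈ MatrixCones.cone (V := V) n) →
    X ∈ MatrixCones.cone (V := V) n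

/-- A linear isomorphism is a complete order isomorphism if at every matrix level it maps the
positive cone onto the positive cone. -/
def IsCompleteOrderIso {V W : Type*} [AddCommGroup V] [Module ℂ V] [MatrixCones V]
    [AddCommGroup W] [Module ℂ W] [MatrixCones W] (Φ : V ≃ₗ[ℂ] W) : Prop :=
  ∀ (n : ℕ) (X : Matrix (Fin n) (Fin n) V),
    X ∈ MatrixCones.cone (V := V) n ↔ X.map Φ ∈ MatrixCones.cone (V := W) n

/-- A faithful state on `V` with unit `e`: a linear functional `f` with `f e = 1`, nonnegative on
positive elements, and vanishing on no nonzero positive element. -/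
structure IsFaithfulState {V : Type*} [AddCommGroup V] [Module ℂ V] [MatrixCones V]
    (e : V) (f : V →ₗ[ℂ] ℂ) : Prop where
  map_unit : f e = 1
  nonneg : ∀ x : V, Matrix.of (fun _ _ : Fin 1 => x) ∈ MatrixCones.cone 1 → 0 ≤ f x
  faithful : ∀ x : V, Matrix.of (fun _ _ : Fin 1 => x) ∈ MatrixCones.cone 1 → f x = 0 → x = 0

/-! ### Subspaces of C⋆-algebras -/

/-- A `⋆`-closed linear subspace of a C⋆-algebra. -/
structure StarSubspace (A : Type*) [CStarAlgebra A] extends Submodule ℂ A where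
  star_mem' : ∀ x ∈ carrier, star x ∈ carrier

/-- The elements of a `⋆`-closed subspace. -/
abbrev StarSubspace.Elem {A : Type*} [CStarAlgebra A] (S : StarSubspace A) : Type _ :=
  S.toSubmodule

instance StarSubspace.instStarAddMonoid {A : Type*} [CStarAlgebra A] (S : StarSubspace A) :
    StarAddMonoid S.Elem where
  star x := ⟨star (x : A), S.star_mem' x x.2⟩
  star_involutive x := Subtype.ext (star_star (x : A))
  star_add x y := Subtype.ext (star_add (x : A) (y : A))

instance StarSubspace.instStarModule {A : Type*} [CStarAlgebra A] (S : StarSubspace A) :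
    StarModule ℂ S.Elem where
  star_smul c x := Subtype.ext (star_smul c (x : A))

/-- The matrix ordering inherited from the C⋆-algebra: a matrix `X` over `S` is positive if it is a
positive element of the C⋆-algebra of matrices over `A`, that is, `X = Y⋆ Y` for some matrix `Y`
over `A`. -/
instance StarSubspace.instMatrixCones {A : Type*} [CStarAlgebra A] (S : StarSubspace A) :
    MatrixCones S.Elem where
  cone n := {X | ∃ Y : Matrix (Fin n) (Fin n) A,
    X.map (fun x : S.Elem => (x : A)) = Y.conjTranspose * Y}

/-! ### The operator system dual -/

/-- The dual space of an operator system (for a finite-dimensional system every linear functional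
is bounded). -/
def OpDual (V : Type*) [AddCommGroup V] [Module ℂ V] : Type _ := V →ₗ[ℂ] ℂ

instance OpDual.instAddCommGroup (V : Type*) [AddCommGroup V] [Module ℂ V] :
    AddCommGroup (OpDual V) := inferInstanceAs (AddCommGroup (V →ₗ[ℂ] ℂ))

instance OpDual.instModule (V : Type*) [AddCommGroup V] [Module ℂ V] :
    Module ℂ (OpDual V) := inferInstanceAs (Module ℂ (V →ₗ[ℂ] ℂ))

instance OpDual.instFunLike (V : Type*) [AddCommGroup V] [Module ℂ V] :
    FunLike (OpDual V) V ℂ := inferInstanceAs (FunLike (V →ₗ[ℂ] ℂ) V ℂ)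

/-- A linear functional, seen as an element of the operator system dual. -/
def OpDual.ofFunctional {V : Type*} [AddCommGroup V] [Module ℂ V] (f : V →ₗ[ℂ] ℂ) : OpDual V := f

/-- The involution `f⋆ x = conj (f (x⋆))` on the dual. -/
instance OpDual.instStarAddMonoid (V : Type*) [AddCommGroup V] [Module ℂ V] [StarAddMonoid V]
    [StarModule ℂ V] : StarAddMonoid (OpDual V) where
  star f := OpDual.ofFunctional
    { toFun := fun x => star (f (star x))
      map_add' := fun x y => by
        have h : f (star x + star y) = f (star x) + f (star y) :=
          LinearMap.map_add (f : V →ₗ[ℂ] ℂ) _ _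
        rw [star_add, h, star_add]
      map_smul' := fun c x => by
        have h : f (star c • star x) = star c * f (star x) :=
          LinearMap.map_smul (f : V →ₗ[ℂ] ℂ) _ _
        rw [star_smul, h, star_mul', star_star]; rfl }
  star_involutive f := by
    refine DFunLike.ext _ _ fun x => ?_
    change star (star (f (star (star x)))) = f x
    rw [star_star, star_star]
  star_add f g := by
    refine DFunLike.ext _ _ fun x => ?_
    exact star_add (f (star x)) (g (star x))

instance OpDual.instStarModule (V : Type*) [AddCommGroup V] [Module ℂ V] [StarAddMonoid V]
    [StarModule ℂ V] : StarModule ℂ (OpDual V) where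
  star_smul c f := by
    refine DFunLike.ext _ _ fun x => ?_
    exact star_mul' c (f (star x))

/-- A matrix `[f i j]` over the dual is positive if the map `x ↦ [f i j x]` into scalar matrices is
completely positive: for each positive matrix `X = [x a b]` over `V`, the scalar block matrix
`[f i j (x a b)]` is positive semidefinite. -/
instance OpDual.instMatrixCones (V : Type*) [AddCommGroup V] [Module ℂ V] [MatrixCones V] :
    MatrixCones (OpDual V) where
  cone q := {F | ∀ (m : ℕ), ∀ X ∈ MatrixCones.cone (V := V) m,
    (Matrix.of fun r s : Fin m × Fin q => F r.2 s.2 (X r.1 s.1)).PosSemidef}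

/-! ### Noncommutative prisms and the systems `S_{k,2}` -/

/-- The free product `ℤ_k * ℤ_2`. -/
abbrev PrismGroup (k : ℕ) : Type :=
  Monoid.Coprod (Multiplicative (ZMod k)) (Multiplicative (ZMod 2))

/-- The canonical unitary `w` of order `k` in `C⋆(ℤ_k * ℤ_2)`. -/
def prismW (k : ℕ) : GroupCStar (PrismGroup k) :=
  GroupCStar.of (Monoid.Coprod.inl (Multiplicative.ofAdd (1 : ZMod k)))

/-- The canonical unitary `v` of order `2` in `C⋆(ℤ_k * ℤ_2)`. -/
def prismV (k : ℕ) : GroupCStar (PrismGroup k) :=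
  GroupCStar.of (Monoid.Coprod.inr (Multiplicative.ofAdd (1 : ZMod 2)))

theorem prismW_pow (k : ℕ) : prismW k ^ k = 1 := by
  rw [prismW, ← GroupCStar.of_pow, ← map_pow, ← ofAdd_nsmul]
  simp [GroupCStar.of_one]

theorem star_prismW_pow {k j : ℕ} (hj : j < k) :
    star (prismW k ^ j) = prismW k ^ ((k - j) % k) := by
  have h : prismW k ^ j * prismW k ^ (k - j) = 1 := by
    rw [← pow_add, Nat.add_sub_cancel' hj.le, prismW_pow]
  have h2 : prismW k ^ ((k - j) % k) = prismW k ^ (k - j) := by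
    conv_rhs => rw [← Nat.mod_add_div (k - j) k, pow_add, pow_mul, prismW_pow, one_pow, mul_one]
  have h3 : star (prismW k ^ j) * prismW k ^ j = 1 := by
    rw [prismW, ← GroupCStar.of_pow, GroupCStar.star_of, ← GroupCStar.of_mul, inv_mul_cancel,
      GroupCStar.of_one]
  rw [h2]
  exact left_inv_eq_right_inv h3 h

theorem star_prismV (k : ℕ) : star (prismV k) = prismV k := by
  rw [prismV, GroupCStar.star_of, ← map_inv, ← ofAdd_neg]
  rfl

/-- The noncommutative `k`-prism `NCP(k) = Span {1, w, …, w ^ (k - 1), v}` in `C⋆(ℤ_k * ℤ_2)`. -/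
def ncPrism (k : ℕ) : StarSubspace (GroupCStar (PrismGroup k)) where
  toSubmodule := Submodule.span ℂ
    (insert 1 (insert (prismV k) (Set.range fun j : Fin k => prismW k ^ (j : ℕ))))
  star_mem' x hx := by
    refine Submodule.span_induction (p := fun x _ => star x ∈ Submodule.span ℂ
      (insert 1 (insert (prismV k) (Set.range fun j : Fin k => prismW k ^ (j : ℕ)))))
      ?_ ?_ ?_ ?_ hx
    · rintro y (rfl | rfl | ⟨j, rfl⟩)
      · rw [star_one]; exact Submodule.subset_span (Or.inl rfl)
      · rw [star_prismV]; exact Submodule.subset_span (Or.inr (Or.inl rfl))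
      · simp only [star_prismW_pow j.2]
        exact Submodule.subset_span
          (Or.inr (Or.inr ⟨⟨(k - j) % k, Nat.mod_lt _ (Fin.pos j)⟩, rfl⟩))
    · rw [star_zero]; exact Submodule.zero_mem _
    · intro x y _ _ hx hy
      rw [star_add]; exact Submodule.add_mem _ hx hy
    · intro c x _ hx
      rw [star_smul]; exact Submodule.smul_mem _ _ hx

/-- The unit of `NCP(k)`. -/
def ncPrismOne (k : ℕ) : (ncPrism k).Elem := ⟨1, Submodule.subset_span (Or.inl rfl)⟩

/-- `v` as an element of `NCP(k)`. -/
def ncPrismV (k : ℕ) : (ncPrism k).Elem :=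
  ⟨prismV k, Submodule.subset_span (Or.inr (Or.inl rfl))⟩

/-- `w ^ j`, `0 ≤ j < k`, as an element of `NCP(k)`. -/
def ncPrismW (k : ℕ) (j : Fin k) : (ncPrism k).Elem :=
  ⟨prismW k ^ (j : ℕ), Submodule.subset_span (Or.inr (Or.inr ⟨j, rfl⟩))⟩

/-- The space `S_{k,2}` of all `z ∈ ℂ^(k+2)` with `z_1 + … + z_k = z_{k+1} + z_{k+2}`, inside the
C⋆-algebra `ℂ^(k+2)`. -/
def sumSystem (k : ℕ) : StarSubspace (Fin (k + 2) → ℂ) where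
  carrier := {z | ∑ j : Fin k, z (Fin.castAdd 2 j) = ∑ l : Fin 2, z (Fin.natAdd k l)}
  add_mem' := by
    intro x y hx hy
    simp only [Set.mem_ofPred_eq, Pi.add_apply, Finset.sum_add_distrib] at *
    rw [hx, hy]
  zero_mem' := by simp
  smul_mem' := by
    intro c x hx
    simp only [Set.mem_ofPred_eq, Pi.smul_apply, ← Finset.smul_sum] at *
    rw [hx]
  star_mem' := by
    intro x hx
    simp only [Set.mem_ofPred_eq, Pi.star_apply, ← star_sum] at *
    exact congrArg star hx

end

/-!
The spectral projections `p_i` of `w` and `q_l` of `v` span `NCP(k)`, and `∑ p_i = 1 = ∑ q_l` is the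
only linear relation among them (`ncPrism_hom_ext`, `exists_abelianFunctional`; independence is seen
on the characters of `ℤ_k * ℤ_2`). Hence
`Φ f = (f(p_1), …, f(p_k), f(q_1), f(q_2))` is a linear bijection of the dual onto `S_{k,2}`.

A matrix over `S_{k,2}` is positive if and only if each of its `k + 2` coordinates is positive
semidefinite, so `Φ` is a complete order isomorphism as soon as a matrix `F` of functionals is
positive exactly when all `F(p_i)` and `F(q_l)` are positive semidefinite
(`mem_cone_opDual_iff`). One direction holds because the `p_i` and `q_l` are positive. For the
other, `∑ F(p_i) = F(1) = ∑ F(q_l)`, and `exists_dilation` dilates the two families on one space: it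
provides a matrix `T` and a representation `ρ` of `C⋆(ℤ_k * ℤ_2)` with `F(p_i) = T⋆ ρ(p_i) T` and
`F(q_l) = T⋆ ρ(q_l) T`. So `F = T⋆ ρ(·) T` on `NCP(k)`, which is completely positive
(`mem_cone_opDual_of_compression`).

In these coordinates a faithful state has strictly positive entries, and any such point is an
Archimedean matrix order unit (`isOperatorSystem_of_coordinates`). The functional `τ` is the
normalized trace of the sum of all characters; it is faithful because the characters separate the
points of `NCP(k)`.
-/

noncomputable section

open Matrix

/-! ### Complex matrices -/

/-- Two matrices with the same Gram matrix differ by a unitary: `A x ↦ B x` is a well-defined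
isometry from the range of `A` to that of `B`, and in finite dimension it extends to a unitary. -/
theorem Matrix.exists_unitary_mul_eq {m n : Type*} [Fintype m] [DecidableEq m] [Fintype n]
    [DecidableEq n] (A B : Matrix m n ℂ) (h : Aᴴ * A = Bᴴ * B) :
    ∃ U ∈ unitary (Matrix m m ℂ), U * A = B := by
  let a := toEuclideanLin A
  let b := toEuclideanLin B
  have key : ∀ (C : Matrix m n ℂ) x, inner ℂ (toEuclideanLin C x) (toEuclideanLin C x) =
      inner ℂ x (toEuclideanLin (Cᴴ * C) x) := by
    intro C x
    rw [← LinearMap.adjoint_inner_right, ← toEuclideanLin_conjTranspose_eq_adjoint]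
    congr 1
    simp [toEuclideanLin, Matrix.toLpLin_apply, Matrix.mulVec_mulVec]
  have hnorm : ∀ x, ‖a x‖ = ‖b x‖ := by
    intro x
    have := (key A x).trans ((h ▸ rfl : _ = _).trans (key B x).symm)
    rw [inner_self_eq_norm_sq_to_K, inner_self_eq_norm_sq_to_K] at this
    have h2 : ‖a x‖ ^ 2 = ‖b x‖ ^ 2 := by exact_mod_cast this
    exact (sq_eq_sq₀ (norm_nonneg _) (norm_nonneg _)).1 h2
  have hker : LinearMap.ker a ≤ LinearMap.ker b := by
    intro x hx
    rw [LinearMap.mem_ker] at hx ⊢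
    rw [← norm_eq_zero, ← hnorm, hx, norm_zero]
  let L₀ := (LinearMap.ker a).liftQ b hker ∘ₗ a.quotKerEquivRange.symm.toLinearMap
  have hL₀ : ∀ x, L₀ ⟨a x, LinearMap.mem_range_self a x⟩ = b x := by
    intro x
    have : a.quotKerEquivRange.symm ⟨a x, LinearMap.mem_range_self a x⟩ =
        (LinearMap.ker a).mkQ x := by
      rw [LinearEquiv.symm_apply_eq]; rfl
    simp [L₀, this]
  let L : LinearMap.range a →ₗᵢ[ℂ] EuclideanSpace ℂ m :=
    ⟨L₀, by rintro ⟨_, x, rfl⟩; rw [hL₀, ← hnorm]; rfl⟩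
  let E := L.extend.toLinearIsometryEquiv rfl
  let u := Unitary.linearIsometryEquiv.symm E
  have hE : ∀ x, E (a x) = b x := fun x =>
    (L.extend_apply ⟨a x, LinearMap.mem_range_self a x⟩).trans (hL₀ x)
  let e := toEuclideanCLM (n := m) (𝕜 := ℂ)
  have hstar : e.symm (star u) = star (e.symm u) := e.symm.map_star' _
  refine ⟨e.symm u, ⟨?_, ?_⟩, ?_⟩
  · rw [← hstar, ← map_mul, Unitary.coe_star_mul_self, map_one]
  · rw [← hstar, ← map_mul, Unitary.mul_star_self_of_mem u.2, map_one]
  · apply toEuclideanLin.injective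
    ext x : 1
    have h1 : toEuclideanLin (e.symm (u : _ →L[ℂ] _) * A) x = e (e.symm u) (a x) := by
      change _ = toEuclideanLin (e.symm u) (a x)
      simp [a, toEuclideanLin, Matrix.toLpLin_apply, Matrix.mulVec_mulVec]
    rw [h1, StarAlgEquiv.apply_symm_apply]
    exact hE x

theorem Matrix.PosSemidef.exists_conjTranspose_mul_self {n : Type*} [Fintype n] [DecidableEq n]
    {A : Matrix n n ℂ} (hA : A.PosSemidef) : ∃ C : Matrix n n ℂ, A = Cᴴ * C := by
  open scoped MatrixOrder Matrix.Norms.L2Operator in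
  exact CStarAlgebra.nonneg_iff_eq_star_mul_self.mp hA.nonneg

theorem Matrix.IsHermitian.exists_pos_smul_one_add {n : Type*} [Fintype n] [DecidableEq n]
    {A : Matrix n n ℂ} (hA : A.IsHermitian) :
    ∃ r : ℝ, 0 < r ∧ ((r : ℂ) • (1 : Matrix n n ℂ) + A).PosSemidef := by
  open scoped MatrixOrder Matrix.Norms.L2Operator in
  have h := IsSelfAdjoint.neg_algebraMap_norm_le_self (a := A) hA
  refine ⟨‖A‖ + 1, by positivity, ?_⟩
  have h1 : (0 : Matrix n n ℂ) ≤ algebraMap ℝ _ ‖A‖ + A := by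
    rwa [← neg_le_iff_add_nonneg']
  have h2 := (Matrix.nonneg_iff_posSemidef.1 h1).add Matrix.PosSemidef.one
  have h3 : ((‖A‖ + 1 : ℝ) : ℂ) • (1 : Matrix n n ℂ) + A = algebraMap ℝ _ ‖A‖ + A + 1 := by
    rw [Algebra.algebraMap_eq_smul_one, Complex.ofReal_add, add_smul, Complex.ofReal_one, one_smul,
      Complex.coe_smul]
    abel
  rwa [h3]

theorem Matrix.posSemidef_of_forall_pos_smul_one_add {n : Type*} [Fintype n] [DecidableEq n]
    {A : Matrix n n ℂ} (h : ∀ r : ℝ, 0 < r → ((r : ℂ) • (1 : Matrix n n ℂ) + A).PosSemidef) :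
    A.PosSemidef := by
  have hA : A.IsHermitian := by
    have := (h 1 one_pos).isHermitian.sub (Matrix.isHermitian_one (n := n) (α := ℂ))
    simpa using this
  refine Matrix.PosSemidef.of_dotProduct_mulVec_nonneg hA fun x => ?_
  have hc : Filter.Tendsto (fun r : ℝ => star x ⬝ᵥ ((r : ℂ) • (1 : Matrix n n ℂ) + A) *ᵥ x)
      (nhdsWithin 0 (Set.Ioi 0)) (nhds (star x ⬝ᵥ A *ᵥ x)) := by
    have : Continuous (fun r : ℝ => star x ⬝ᵥ ((r : ℂ) • (1 : Matrix n n ℂ) + A) *ᵥ x) := by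
      fun_prop
    have := (this.tendsto 0).mono_left (nhdsWithin_le_nhds (s := Set.Ioi 0))
    simpa using this
  refine ge_of_tendsto hc ?_
  filter_upwards [self_mem_nhdsWithin] with r hr
  exact (h r hr).dotProduct_mulVec_nonneg x

/-! ### Operator systems cut out by positive semidefinite coordinates -/

/-- Suppose finitely many `⋆`-preserving functionals `ev t` separate the points of `V`, and a matrix
over `V` is positive exactly when its image under each of them is positive semidefinite. Then every
`e` on which all of them are strictly positive is an Archimedean matrix order unit. Both
`NCP(k)^δ` and `S_{k,2}` are of this kind. -/
theorem isOperatorSystem_of_coordinates {V : Type*} [AddCommGroup V] [Module ℂ V] [StarAddMonoid V]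
    [StarModule ℂ V] [MatrixCones V] {T : Type*} [Finite T] (ev : T → V →ₗ[ℂ] ℂ)
    (hstar : ∀ t x, ev t (star x) = star (ev t x)) (hinj : ∀ x, (∀ t, ev t x = 0) → x = 0)
    (hcone : ∀ (n : ℕ) (X : Matrix (Fin n) (Fin n) V),
      X ∈ MatrixCones.cone (V := V) n ↔ ∀ t, (X.map (ev t)).PosSemidef)
    (e : V) (he : ∀ t, 0 < ev t e) : IsOperatorSystem e := by
  have hinj' : ∀ x y, (∀ t, ev t x = ev t y) → x = y := fun x y h =>
    sub_eq_zero.1 (hinj _ fun t => by rw [map_sub, h, sub_self])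
  have hherm : ∀ {n : ℕ} {X : Matrix (Fin n) (Fin n) V}, X.IsHermitian →
      ∀ t, (X.map (ev t)).IsHermitian := by
    intro n X hX t
    ext i j
    simp only [conjTranspose_apply, map_apply]
    rw [← hstar, hX.apply]
  have hunit : ∀ (t : T), ∃ c : ℝ, 0 < c ∧ ev t e = c := by
    intro t
    obtain ⟨h1, h2⟩ := Complex.pos_iff.1 (he t)
    exact ⟨(ev t e).re, h1, Complex.ext rfl (by simpa using h2.symm)⟩
  have hmap : ∀ {n : ℕ} (X : Matrix (Fin n) (Fin n) V) (r : ℂ) t,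
      (r • Matrix.diagonal (fun _ => e) + X).map (ev t) =
        (r * ev t e) • (1 : Matrix (Fin n) (Fin n) ℂ) + X.map (ev t) := by
    intro n X r t
    ext i j
    by_cases h : i = j <;> simp [h]
  refine ⟨?_, ?_, ?_, ?_, ?_, ?_, ?_, ?_⟩
  · intro n X hX
    rw [hcone] at hX
    ext i j
    refine hinj' _ _ fun t => ?_
    rw [conjTranspose_apply, hstar]
    exact (hX t).isHermitian.apply i j
  · intro n X hX Y hY
    rw [hcone] at *
    intro t
    have := (hX t).add (hY t)
    rwa [← Matrix.map_add _ (map_add (ev t))] at this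
  · intro n r hr X hX
    rw [hcone] at *
    intro t
    have := (hX t).smul (a := (r : ℂ)) (by exact_mod_cast hr)
    convert this using 1
    ext i j
    simp
  · intro n X hX hX'
    rw [hcone] at *
    ext i j
    refine hinj _ fun t => ?_
    open scoped MatrixOrder in
    have h0 : X.map (ev t) = 0 := by
      refine le_antisymm ?_ (hX t).nonneg
      rw [← neg_nonneg]
      have := (hX' t).nonneg
      rwa [show (-X).map (ev t) = -X.map (ev t) by ext; simp] at this
    exact congrFun (congrFun h0 i) j
  · intro n m α X hX
    rw [hcone] at *
    intro t
    have := (hX t).conjTranspose_mul_mul_same α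
    convert this using 1
    ext i j
    simp only [compress, map_apply, of_apply, map_sum, map_smul, mul_apply, conjTranspose_apply,
      smul_eq_mul, Finset.sum_mul]
    rw [Finset.sum_comm]
    exact Finset.sum_congr rfl fun _ _ => Finset.sum_congr rfl fun _ _ => by ring
  · refine hinj' _ _ fun t => ?_
    obtain ⟨c, -, hc⟩ := hunit t
    rw [hstar, hc]
    exact Complex.conj_ofReal c
  · intro n X hX
    cases nonempty_fintype T
    choose c hc0 hc using hunit
    choose r hr0 hr using fun t => (hherm hX t).exists_pos_smul_one_add
    -- If `r t + ev t X ≥ 0` and `ev t e = c t`, any `r ≥ r t / c t` works at `t`.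
    refine ⟨∑ t, r t / c t + 1, ?_, ?_⟩
    · have : 0 ≤ ∑ t, r t / c t := Finset.sum_nonneg fun t _ => (div_pos (hr0 t) (hc0 t)).le
      linarith
    · rw [hcone]
      intro t
      have hle : r t / c t ≤ ∑ t, r t / c t :=
        Finset.single_le_sum (fun t _ => (div_pos (hr0 t) (hc0 t)).le) (Finset.mem_univ t)
      have hle' : 0 ≤ (∑ t, r t / c t + 1) * c t - r t := by
        have := (div_le_iff₀ (hc0 t)).1 (hle.trans (lt_add_one _).le)
        linarith
      have := (hr t).add ((PosSemidef.one (n := Fin n) (R := ℂ)).smul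
        (a := (((∑ t, r t / c t + 1) * c t - r t : ℝ) : ℂ)) (by exact_mod_cast hle'))
      rw [hmap, hc]
      convert this using 1
      rw [add_right_comm, ← add_smul]
      congr 2
      push_cast
      ring
  · intro n X hX h
    rw [hcone]
    intro t
    obtain ⟨c, hc0, hc⟩ := hunit t
    refine posSemidef_of_forall_pos_smul_one_add fun r hr => ?_
    have := (hcone _ _).1 (h (r / c) (by positivity)) t
    rw [hmap, hc, ← Complex.ofReal_mul, div_mul_cancel₀ _ hc0.ne'] at this
    exact this

/-! ### Matrix representations of full group C⋆-algebras -/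

/-- A homomorphism into unitary matrices, seen as a unitary representation on `ℂ^ι`. -/
def UnitaryRep.ofMatrix {G : Type} [Group G] {ι : Type} [Fintype ι] [DecidableEq ι] [Nonempty ι]
    (θ : G →* unitary (Matrix ι ι ℂ)) : UnitaryRep G where
  H := EuclideanSpace ℂ ι
  hom := (Unitary.map (R := Matrix ι ι ℂ) (S := EuclideanSpace ℂ ι →L[ℂ] EuclideanSpace ℂ ι)
    ⟨(toEuclideanCLM (n := ι) (𝕜 := ℂ)).toRingEquiv.toMonoidHom,
      toEuclideanCLM.map_star'⟩).toMonoidHom.comp θ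

/-- The extension of a unitary representation to `C⋆(G)`: the coordinate projection of the product
over all representations. -/
def GroupCStar.eval {G : Type u} [Group G] (π : UnitaryRep G) : GroupCStar G →⋆ₐ[ℂ] π.Op where
  toFun x := (x : RepProduct G) π
  map_one' := rfl
  map_mul' _ _ := rfl
  map_zero' := rfl
  map_add' _ _ := rfl
  commutes' _ := rfl
  map_star' _ := rfl

/-- The extension to `C⋆(G)` of a homomorphism from `G` into unitary matrices. -/
def GroupCStar.matrixRep {G : Type} [Group G] {ι : Type} [Fintype ι] [DecidableEq ι] [Nonempty ι]
    (θ : G →* unitary (Matrix ι ι ℂ)) : GroupCStar G →⋆ₐ[ℂ] Matrix ι ι ℂ :=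
  (toEuclideanCLM (n := ι) (𝕜 := ℂ)).symm.toStarAlgHom.comp
    (GroupCStar.eval (UnitaryRep.ofMatrix θ))

/-- The canonical homomorphism from `G` to the unitary group of `C⋆(G)`. -/
def GroupCStar.unitaryOf (G : Type u) [Group G] : G →* unitary (GroupCStar G) where
  toFun g := ⟨GroupCStar.of g, by
    rw [Unitary.mem_iff, GroupCStar.star_of, ← GroupCStar.of_mul, ← GroupCStar.of_mul,
      inv_mul_cancel, mul_inv_cancel, GroupCStar.of_one]
    exact ⟨rfl, rfl⟩⟩
  map_one' := Subtype.ext GroupCStar.of_one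
  map_mul' g h := Subtype.ext (GroupCStar.of_mul g h)

theorem GroupCStar.matrixRep_unitaryOf {G : Type} [Group G] {ι : Type} [Fintype ι] [DecidableEq ι]
    [Nonempty ι] (θ : G →* unitary (Matrix ι ι ℂ)) (g : G) :
    GroupCStar.matrixRep θ (GroupCStar.unitaryOf G g) = θ g :=
  (toEuclideanCLM (n := ι) (𝕜 := ℂ)).symm_apply_apply _

/-! ### Spectral projections of unitaries of finite order -/

section
variable {n : ℕ} [NeZero n]

theorem sum_stdAddChar_mul (j : ZMod n) :
    ∑ i : ZMod n, (ZMod.stdAddChar (i * j) : ℂ) = if j = 0 then (n : ℂ) else 0 := by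
  have := AddChar.sum_mulShift j (ZMod.isPrimitive_stdAddChar n)
  rw [ZMod.card] at this
  exact_mod_cast this

theorem star_stdAddChar (j : ZMod n) :
    star (ZMod.stdAddChar j : ℂ) = ZMod.stdAddChar (-j) :=
  (AddChar.map_neg_eq_conj _ _).symm

variable {A : Type*} [Ring A] [StarRing A] [Algebra ℂ A]
  (ψ : Multiplicative (ZMod n) →* unitary A)

/-- The spectral projection `n⁻¹ ∑_j χ(-ij) u^j` of a unitary `u` with `u ^ n = 1`, for the
eigenvalue `χ(i) = exp(2πi · i/n)`. The unitary is given by the homomorphism `ψ : j ↦ u^j`. -/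
def spectralProj (i : ZMod n) : A :=
  (n : ℂ)⁻¹ • ∑ j : ZMod n,
    (ZMod.stdAddChar (-(i * j)) : ℂ) • (ψ (Multiplicative.ofAdd j) : A)

/-- Fourier inversion on `ℤ_n`: the spectral decomposition of `u^j`. -/
theorem coe_eq_sum_spectralProj (j : ZMod n) :
    (ψ (Multiplicative.ofAdd j) : A) =
      ∑ i : ZMod n, (ZMod.stdAddChar (i * j) : ℂ) • spectralProj ψ i := by
  have hn : (n : ℂ) ≠ 0 := NeZero.ne _
  have h : ∀ i m : ZMod n, (ZMod.stdAddChar (i * j) : ℂ) * ZMod.stdAddChar (-(i * m)) =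
      ZMod.stdAddChar (i * (j - m)) := by
    intro i m
    rw [← AddChar.map_add_eq_mul]
    congr 1
    ring
  simp only [spectralProj, Finset.smul_sum]
  rw [Finset.sum_comm]
  simp only [smul_smul, mul_left_comm _ (n : ℂ)⁻¹, h]
  simp only [← Finset.sum_smul, ← Finset.mul_sum, sum_stdAddChar_mul, sub_eq_zero]
  simp [hn]

theorem sum_spectralProj : ∑ i : ZMod n, spectralProj ψ i = 1 := by
  simpa using (coe_eq_sum_spectralProj ψ 0).symm

/-- The powers of the diagonal unitary whose eigenvalue at the basis vector `a` is `χ(g a)`. -/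
def characterDiag {ι : Type} [Fintype ι] [DecidableEq ι] (g : ι → ZMod n) :
    Multiplicative (ZMod n) →* unitary (Matrix ι ι ℂ) where
  toFun j := ⟨diagonal fun a => ZMod.stdAddChar (g a * j.toAdd), by
    rw [Unitary.mem_iff]
    constructor <;>
    · rw [star_eq_conjTranspose, diagonal_conjTranspose, diagonal_mul_diagonal, ← diagonal_one]
      congr 1
      funext a
      rw [Pi.star_apply, star_stdAddChar, ← AddChar.map_add_eq_mul]
      simp⟩
  map_one' := by ext1; simp
  map_mul' i j := by
    ext1
    simp [mul_add, AddChar.map_add_eq_mul]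

/-- If `ρ` sends `u` to `U⋆ diag(χ(g a)) U`, then it sends the `i`-th spectral projection of `u` to
the conjugate under `U` of the coordinate projection onto `{a | g a = i}`. -/
theorem map_spectralProj {ι : Type} [Fintype ι] [DecidableEq ι] (g : ι → ZMod n)
    (U : Matrix ι ι ℂ) (ρ : A →⋆ₐ[ℂ] Matrix ι ι ℂ)
    (hρ : ∀ j, ρ (ψ j) = Uᴴ * characterDiag g j * U) (i : ZMod n) :
    ρ (spectralProj ψ i) = Uᴴ * diagonal (fun a => if g a = i then 1 else 0) * U := by
  have hn : (n : ℂ) ≠ 0 := NeZero.ne _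
  have : diagonal (fun a => if g a = i then (1 : ℂ) else 0) = (n : ℂ)⁻¹ • ∑ j : ZMod n,
      (ZMod.stdAddChar (-(i * j)) : ℂ) •
        (characterDiag g (Multiplicative.ofAdd j) : Matrix ι ι ℂ) := by
    ext a b
    rw [Matrix.smul_apply, Matrix.sum_apply]
    by_cases hab : a = b
    · subst hab
      have h : ∀ j : ZMod n, (ZMod.stdAddChar (-(i * j)) : ℂ) * ZMod.stdAddChar (g a * j) =
          ZMod.stdAddChar (j * (g a - i)) := by
        intro j
        rw [← AddChar.map_add_eq_mul]
        congr 1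
        ring
      simp [characterDiag, h, sum_stdAddChar_mul, sub_eq_zero, hn]
    · simp [characterDiag, hab]
  rw [this, spectralProj]
  simp [hρ, Matrix.mul_sum, Matrix.sum_mul]

theorem coe_mul_spectralProj (i m : ZMod n) :
    (ψ (Multiplicative.ofAdd m) : A) * spectralProj ψ i =
      (ZMod.stdAddChar (i * m) : ℂ) • spectralProj ψ i := by
  rw [spectralProj, mul_smul_comm, smul_comm]
  congr 1
  rw [Finset.mul_sum, Finset.smul_sum]
  refine Fintype.sum_equiv (Equiv.addLeft m) _ _ fun j => ?_
  rw [mul_smul_comm, ← Submonoid.coe_mul, ← map_mul, ← ofAdd_add, smul_smul,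
    ← AddChar.map_add_eq_mul, Equiv.coe_addLeft]
  congr 2
  ring

variable [StarModule ℂ A]

/-- The elements `spectralProj ψ i` are projections; in particular they are of the form `Y⋆ Y`. -/
theorem star_spectralProj_mul_self (i : ZMod n) :
    star (spectralProj ψ i) * spectralProj ψ i = spectralProj ψ i := by
  have hn : (n : ℂ) ≠ 0 := NeZero.ne _
  conv_lhs => enter [1]; rw [spectralProj]
  rw [star_smul, star_sum, smul_mul_assoc, Finset.sum_mul]
  have : ∀ j : ZMod n, star ((ZMod.stdAddChar (-(i * j)) : ℂ) •
      (ψ (Multiplicative.ofAdd j) : A)) * spectralProj ψ i = spectralProj ψ i := by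
    intro j
    rw [star_smul, ← Unitary.coe_star, Unitary.star_eq_inv, ← map_inv, ← ofAdd_neg, smul_mul_assoc,
      coe_mul_spectralProj, smul_smul, star_stdAddChar, ← AddChar.map_add_eq_mul]
    simp
  rw [Finset.sum_congr rfl fun j _ => this j]
  rw [Finset.sum_const, Finset.card_univ, ZMod.card, ← Nat.cast_smul_eq_nsmul ℂ, smul_smul]
  simp [hn]

theorem star_spectralProj (i : ZMod n) : star (spectralProj ψ i) = spectralProj ψ i := by
  rw [← star_spectralProj_mul_self, star_mul, star_star]

end

/-! ### Representations of the free product -/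

section
variable (k : ℕ)

/-- The powers `j ↦ w^j` of the canonical unitary of order `k`. -/
def prismInl : Multiplicative (ZMod k) →* unitary (GroupCStar (PrismGroup k)) :=
  (GroupCStar.unitaryOf _).comp Monoid.Coprod.inl

/-- The powers `l ↦ v^l` of the canonical unitary of order `2`. -/
def prismInr : Multiplicative (ZMod 2) →* unitary (GroupCStar (PrismGroup k)) :=
  (GroupCStar.unitaryOf _).comp Monoid.Coprod.inr

variable [NeZero k] {ι : Type} [Fintype ι] [DecidableEq ι] [Nonempty ι]
  (g : ι → ZMod k) (h : ι → ZMod 2) (U : unitary (Matrix ι ι ℂ))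

/-- The representation of `C⋆(ℤ_k * ℤ_2)` with `w ↦ diag(χ(g a))` and `v ↦ U⋆ diag(±1) U`, where
the sign at `a` is `(-1)^(h a)`. -/
def prismRep : GroupCStar (PrismGroup k) →⋆ₐ[ℂ] Matrix ι ι ℂ :=
  GroupCStar.matrixRep (Monoid.Coprod.lift (characterDiag g)
    ((MulAut.conj U⁻¹).toMonoidHom.comp (characterDiag h)))

theorem prismRep_spectralProj_inl (i : ZMod k) :
    prismRep k g h U (spectralProj (prismInl k) i) =
      diagonal fun a => if g a = i then 1 else 0 := by
  rw [map_spectralProj (prismInl k) g 1]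
  · simp
  · intro j
    simp [prismInl, prismRep, GroupCStar.matrixRep_unitaryOf]

theorem prismRep_spectralProj_inr (l : ZMod 2) :
    prismRep k g h U (spectralProj (prismInr k) l) =
      (U : Matrix ι ι ℂ)ᴴ * (diagonal fun a => if h a = l then 1 else 0) * (U : Matrix ι ι ℂ) := by
  rw [map_spectralProj (prismInr k) h U]
  intro j
  simp [prismInr, prismRep, GroupCStar.matrixRep_unitaryOf, star_eq_conjTranspose]

end

/-! ### Spectral projections as a spanning set of the noncommutative prism -/

/-- A shortcut for instance search. -/
instance StarSubspace.instSMulElem {A : Type*} [CStarAlgebra A] (S : StarSubspace A) :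
    SMul ℂ S.Elem :=
  (S.toSubmodule.module.toDistribMulAction.toMulAction).toSMul

section
variable (k : ℕ)

theorem prismInr_mem (l : ZMod 2) :
    (prismInr k (Multiplicative.ofAdd l) : GroupCStar (PrismGroup k)) ∈
      (ncPrism k).toSubmodule := by
  fin_cases l
  · exact Submodule.subset_span (Or.inl (congrArg Subtype.val (map_one (prismInr k))))
  · exact Submodule.subset_span (Or.inr (Or.inl rfl))

/-- The spectral projections of `v`, as elements of `NCP(k)`. -/
def prismQ (l : ZMod 2) : (ncPrism k).Elem :=
  ⟨spectralProj (prismInr k) l, Submodule.smul_mem _ _ <| Submodule.sum_mem _ fun j _ =>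
    Submodule.smul_mem _ _ (prismInr_mem k j)⟩

theorem sum_prismQ : ∑ l, prismQ k l = ncPrismOne k := by
  apply Subtype.ext
  rw [Submodule.coe_sum]
  exact sum_spectralProj (prismInr k)

theorem ncPrismV_eq_sum :
    ncPrismV k = ∑ l : ZMod 2, (ZMod.stdAddChar (l * 1) : ℂ) • prismQ k l := by
  apply Subtype.ext
  rw [Submodule.coe_sum]
  exact coe_eq_sum_spectralProj (prismInr k) 1

theorem prismQ_mem_cone (l : ZMod 2) :
    Matrix.of (fun _ _ : Fin 1 => prismQ k l) ∈ MatrixCones.cone 1 := by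
  refine ⟨Matrix.of fun _ _ => (prismQ k l : GroupCStar (PrismGroup k)), ?_⟩
  ext1 a b
  rw [Matrix.mul_apply, Finset.univ_unique, Finset.sum_singleton]
  exact (star_spectralProj_mul_self (prismInr k) l).symm

theorem star_prismQ (l : ZMod 2) : star (prismQ k l) = prismQ k l :=
  Subtype.ext (star_spectralProj (prismInr k) l)

variable [NeZero k]

theorem prismInl_apply (j : ZMod k) :
    (prismInl k (Multiplicative.ofAdd j) : GroupCStar (PrismGroup k)) = prismW k ^ j.val := by
  have h : Multiplicative.ofAdd j = Multiplicative.ofAdd (1 : ZMod k) ^ j.val := by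
    rw [← ofAdd_nsmul, nsmul_one, ZMod.natCast_zmod_val]
  change GroupCStar.of (Monoid.Coprod.inl (Multiplicative.ofAdd j)) = _
  rw [h, map_pow, GroupCStar.of_pow, prismW]

theorem prismInl_mem (j : ZMod k) :
    (prismInl k (Multiplicative.ofAdd j) : GroupCStar (PrismGroup k)) ∈
      (ncPrism k).toSubmodule := by
  rw [prismInl_apply]
  exact Submodule.subset_span (Or.inr (Or.inr ⟨⟨j.val, ZMod.val_lt j⟩, rfl⟩))

/-- The spectral projections of `w`, as elements of `NCP(k)`. -/
def prismP (i : ZMod k) : (ncPrism k).Elem :=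
  ⟨spectralProj (prismInl k) i, Submodule.smul_mem _ _ <| Submodule.sum_mem _ fun j _ =>
    Submodule.smul_mem _ _ (prismInl_mem k j)⟩

theorem sum_prismP : ∑ i, prismP k i = ncPrismOne k := by
  apply Subtype.ext
  rw [Submodule.coe_sum]
  exact sum_spectralProj (prismInl k)

theorem ncPrismW_eq_sum (j : Fin k) :
    ncPrismW k j = ∑ i : ZMod k, (ZMod.stdAddChar (i * ((j : ℕ) : ZMod k)) : ℂ) • prismP k i := by
  apply Subtype.ext
  rw [Submodule.coe_sum]
  have := coe_eq_sum_spectralProj (prismInl k) ((j : ℕ) : ZMod k)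
  rw [prismInl_apply, ZMod.val_cast_of_lt j.2] at this
  exact this

theorem prismP_mem_cone (i : ZMod k) :
    Matrix.of (fun _ _ : Fin 1 => prismP k i) ∈ MatrixCones.cone 1 := by
  refine ⟨Matrix.of fun _ _ => (prismP k i : GroupCStar (PrismGroup k)), ?_⟩
  ext1 a b
  rw [Matrix.mul_apply, Finset.univ_unique, Finset.sum_singleton]
  exact (star_spectralProj_mul_self (prismInl k) i).symm

theorem star_prismP (i : ZMod k) : star (prismP k i) = prismP k i :=
  Subtype.ext (star_spectralProj (prismInl k) i)

variable {k}

/-- The spectral projections of `w` and `v` span `NCP(k)`. -/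
theorem ncPrism_hom_ext {f g : (ncPrism k).Elem →ₗ[ℂ] ℂ}
    (hP : ∀ i, f (prismP k i) = g (prismP k i))
    (hQ : ∀ l, f (prismQ k l) = g (prismQ k l)) : f = g := by
  have hle : (ncPrism k).toSubmodule ≤
      (LinearMap.eqLocus f g).map (ncPrism k).toSubmodule.subtype := by
    refine Submodule.span_le.2 ?_
    rintro _ (rfl | rfl | ⟨j, rfl⟩)
    · refine ⟨ncPrismOne k, ?_, rfl⟩
      rw [← sum_prismP]
      exact Submodule.sum_mem _ fun i _ => hP i
    · refine ⟨ncPrismV k, ?_, rfl⟩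
      rw [ncPrismV_eq_sum]
      exact Submodule.sum_mem _ fun l _ => Submodule.smul_mem _ _ (hQ l)
    · refine ⟨ncPrismW k j, ?_, rfl⟩
      rw [ncPrismW_eq_sum]
      exact Submodule.sum_mem _ fun i _ => Submodule.smul_mem _ _ (hP i)
  ext x
  obtain ⟨y, hy, hyx⟩ := hle x.2
  obtain rfl : y = x := Subtype.ext hyx
  exact hy

variable (k)

/-! ### Functionals that factor through the abelianization -/

/-- The regular representation of the abelianization `ℤ_k × ℤ_2`, diagonalized: the direct sum of
all characters of `ℤ_k * ℤ_2`. -/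
def abelianRep :
    GroupCStar (PrismGroup k) →⋆ₐ[ℂ] Matrix (ZMod k × ZMod 2) (ZMod k × ZMod 2) ℂ :=
  prismRep k Prod.fst Prod.snd 1

/-- The combination, with weights `c`, of the characters of `ℤ_k * ℤ_2`, restricted to `NCP(k)`. -/
def abelianFunctional (c : ZMod k × ZMod 2 → ℂ) : (ncPrism k).Elem →ₗ[ℂ] ℂ where
  toFun x := ∑ a, c a * abelianRep k x a a
  map_add' x y := by simp [mul_add, Finset.sum_add_distrib]
  map_smul' r x := by simp [Finset.mul_sum, mul_left_comm]

theorem abelianFunctional_prismP (c : ZMod k × ZMod 2 → ℂ) (i : ZMod k) :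
    abelianFunctional k c (prismP k i) = ∑ l, c (i, l) := by
  change ∑ a, c a * prismRep k Prod.fst Prod.snd 1 (spectralProj (prismInl k) i) a a = _
  rw [prismRep_spectralProj_inl, Fintype.sum_prod_type_right]
  simp

theorem abelianFunctional_prismQ (c : ZMod k × ZMod 2 → ℂ) (l : ZMod 2) :
    abelianFunctional k c (prismQ k l) = ∑ i, c (i, l) := by
  change ∑ a, c a * prismRep k Prod.fst Prod.snd 1 (spectralProj (prismInr k) l) a a = _
  rw [prismRep_spectralProj_inr, Fintype.sum_prod_type]
  simp

/-- Functionals on `NCP(k)` can be prescribed on the spectral projections, subject only to the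
relation `∑ z_i = ∑ z'_l`, and combinations of characters suffice. In particular `∑ p_i = ∑ q_l`
is the only linear relation among the spectral projections. -/
theorem exists_abelianFunctional (z : ZMod k → ℂ) (z' : ZMod 2 → ℂ) (h : ∑ i, z i = ∑ l, z' l) :
    ∃ c, (∀ i, abelianFunctional k c (prismP k i) = z i) ∧
      ∀ l, abelianFunctional k c (prismQ k l) = z' l := by
  have hk : (k : ℂ) ≠ 0 := NeZero.ne _
  -- A matrix with row sums `z` and column sums `z'`.
  refine ⟨fun a => z a.1 / 2 + z' a.2 / k - (∑ i, z i) / (2 * k), fun i => ?_, fun l => ?_⟩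
  · rw [abelianFunctional_prismP]
    rw [Finset.sum_sub_distrib, Finset.sum_add_distrib, ← Finset.sum_div _ z', ← h]
    simp only [Finset.sum_const, Finset.card_univ, ZMod.card, nsmul_eq_mul]
    push_cast
    field_simp
    ring
  · rw [abelianFunctional_prismQ]
    rw [Finset.sum_sub_distrib, Finset.sum_add_distrib, ← Finset.sum_div _ z]
    simp only [Finset.sum_const, Finset.card_univ, ZMod.card, nsmul_eq_mul]
    field_simp
    ring

theorem sum_apply_prismP_eq (f : (ncPrism k).Elem →ₗ[ℂ] ℂ) :
    ∑ i, f (prismP k i) = ∑ l, f (prismQ k l) := by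
  rw [← map_sum, ← map_sum, sum_prismP, sum_prismQ]

/-- The characters of `ℤ_k * ℤ_2` separate the points of `NCP(k)`. -/
theorem eq_zero_of_abelianRep_eq_zero (x : (ncPrism k).Elem) (hx : abelianRep k x = 0) : x = 0 := by
  refine (Module.forall_dual_apply_eq_zero_iff ℂ x).1 fun f => ?_
  obtain ⟨c, hP, hQ⟩ := exists_abelianFunctional k (fun i => f (prismP k i))
    (fun l => f (prismQ k l)) (sum_apply_prismP_eq k f)
  rw [← ncPrism_hom_ext hP hQ]
  simp [abelianFunctional, hx]

/-- The functional `τ`, as the normalized trace of `abelianRep`. -/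
def prismTrace : (ncPrism k).Elem →ₗ[ℂ] ℂ := abelianFunctional k fun _ => 1 / (2 * k)

theorem prismTrace_apply (x : (ncPrism k).Elem) :
    prismTrace k x = 1 / (2 * k) * (abelianRep k x).trace := by
  simp [prismTrace, abelianFunctional, Matrix.trace, Finset.mul_sum]

theorem prismTrace_prismP (i : ZMod k) : prismTrace k (prismP k i) = 1 / k := by
  have hk : (k : ℂ) ≠ 0 := NeZero.ne _
  rw [prismTrace, abelianFunctional_prismP]
  simp only [Finset.sum_const, Finset.card_univ, ZMod.card, nsmul_eq_mul]
  field_simp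
  norm_num

theorem prismTrace_prismQ (l : ZMod 2) : prismTrace k (prismQ k l) = 1 / 2 := by
  have hk : (k : ℂ) ≠ 0 := NeZero.ne _
  rw [prismTrace, abelianFunctional_prismQ]
  simp only [Finset.sum_const, Finset.card_univ, ZMod.card, nsmul_eq_mul]
  field_simp

theorem prismTrace_ncPrismW (j : Fin k) (hj : (j : ℕ) ≠ 0) : prismTrace k (ncPrismW k j) = 0 := by
  have hj' : ((j : ℕ) : ZMod k) ≠ 0 := by
    rw [Ne, ZMod.natCast_eq_zero_iff]
    exact fun h => hj (Nat.eq_zero_of_dvd_of_lt h j.2)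
  rw [ncPrismW_eq_sum, map_sum]
  simp only [map_smul, prismTrace_prismP, smul_eq_mul]
  rw [← Finset.sum_mul, sum_stdAddChar_mul, if_neg hj', zero_mul]

theorem prismTrace_ncPrismV : prismTrace k (ncPrismV k) = 0 := by
  rw [ncPrismV_eq_sum, map_sum]
  simp only [map_smul, prismTrace_prismQ, smul_eq_mul]
  rw [← Finset.sum_mul, sum_stdAddChar_mul, if_neg one_ne_zero, zero_mul]

/-- Faithfulness: a positive element of trace zero is killed by `abelianRep`, which is injective on
`NCP(k)`. -/
theorem isFaithfulState_prismTrace : IsFaithfulState (ncPrismOne k) (prismTrace k) := by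
  have hk : (k : ℂ) ≠ 0 := NeZero.ne _
  have hk' : (0 : ℂ) < 1 / (2 * k) := by
    have : 0 < k := Nat.pos_of_ne_zero (NeZero.ne k)
    positivity
  have hpos : ∀ x : (ncPrism k).Elem, Matrix.of (fun _ _ : Fin 1 => x) ∈ MatrixCones.cone 1 →
      ∃ B : Matrix (ZMod k × ZMod 2) (ZMod k × ZMod 2) ℂ, abelianRep k x = Bᴴ * B := by
    rintro x ⟨Y, hY⟩
    have := congrFun (congrFun hY 0) 0
    refine ⟨abelianRep k (Y 0 0), ?_⟩
    rw [← star_eq_conjTranspose, ← map_star, ← map_mul]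
    congr 1
    simpa [Matrix.mul_apply] using this
  refine ⟨?_, fun x hx => ?_, fun x hx h0 => ?_⟩
  · rw [← sum_prismP, map_sum]
    simp [prismTrace_prismP, hk]
  · obtain ⟨B, hB⟩ := hpos x hx
    rw [prismTrace_apply, hB]
    exact mul_nonneg hk'.le (posSemidef_conjTranspose_mul_self B).trace_nonneg
  · obtain ⟨B, hB⟩ := hpos x hx
    rw [prismTrace_apply, hB] at h0
    have hB0 := trace_conjTranspose_mul_self_eq_zero_iff.1
      ((mul_eq_zero.1 h0).resolve_left hk'.ne')
    exact eq_zero_of_abelianRep_eq_zero k x (by rw [hB, hB0, mul_zero])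

variable {k}

theorem IsFaithfulState.pos_prismP {μ : (ncPrism k).Elem →ₗ[ℂ] ℂ}
    (hμ : IsFaithfulState (ncPrismOne k) μ) (i : ZMod k) : 0 < μ (prismP k i) := by
  refine (hμ.nonneg _ (prismP_mem_cone k i)).lt_of_ne fun h => ?_
  have := prismTrace_prismP k i
  rw [hμ.faithful _ (prismP_mem_cone k i) h.symm, map_zero] at this
  exact one_div_ne_zero (NeZero.ne (k : ℂ)) this.symm

theorem IsFaithfulState.pos_prismQ {μ : (ncPrism k).Elem →ₗ[ℂ] ℂ}
    (hμ : IsFaithfulState (ncPrismOne k) μ) (l : ZMod 2) : 0 < μ (prismQ k l) := by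
  refine (hμ.nonneg _ (prismQ_mem_cone k l)).lt_of_ne fun h => ?_
  have := prismTrace_prismQ k l
  rw [hμ.faithful _ (prismQ_mem_cone k l) h.symm, map_zero] at this
  norm_num at this

end

/-! ### Dilation and complete positivity -/

section
variable {k : ℕ} [NeZero k]

/-- A compression `e ↦ T⋆ ρ(e) T` of a `⋆`-representation is completely positive. -/
theorem mem_cone_opDual_of_compression {A : Type*} [CStarAlgebra A] {V : StarSubspace A}
    {ι : Type*} [Fintype ι] [DecidableEq ι] {q : ℕ} (ρ : A →⋆ₐ[ℂ] Matrix ι ι ℂ)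
    (T : Matrix ι (Fin q) ℂ) (F : Matrix (Fin q) (Fin q) (OpDual V.Elem))
    (hF : ∀ x y (e : V.Elem), F x y e = (Tᴴ * ρ (e : A) * T) x y) : F ∈ MatrixCones.cone q := by
  rintro m X ⟨Y, hY⟩
  let Z : Matrix (Fin m × ι) (Fin m × Fin q) ℂ :=
    Matrix.of fun r s => (ρ (Y r.1 s.1) * T) r.2 s.2
  have hZ : (Matrix.of fun r s : Fin m × Fin q => F r.2 s.2 (X r.1 s.1)) = Zᴴ * Z := by
    ext ⟨a, x⟩ ⟨b, y⟩
    have hX : (X a b : A) = ∑ c, star (Y c a) * Y c b := congrFun (congrFun hY a) b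
    have hρ : ∀ c, Tᴴ * (star (ρ (Y c a)) * ρ (Y c b)) * T =
        (ρ (Y c a) * T)ᴴ * (ρ (Y c b) * T) := by
      intro c
      rw [conjTranspose_mul, star_eq_conjTranspose]
      simp only [Matrix.mul_assoc]
    rw [Matrix.of_apply, hF, hX, map_sum, Matrix.mul_sum, Matrix.sum_mul, Matrix.sum_apply,
      Matrix.mul_apply, Fintype.sum_prod_type]
    refine Finset.sum_congr rfl fun c _ => ?_
    rw [map_mul, map_star, hρ, Matrix.mul_apply]
    rfl
  rw [hZ]
  exact posSemidef_conjTranspose_mul_self Z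

/-- Two positive matrix partitions `A`, `B` of the same matrix dilate simultaneously to a
representation of `C⋆(ℤ_k * ℤ_2)`. Each has a Naimark-type dilation, `A i = T⋆ P_i T` and
`B l = S⋆ Q_l S` with coordinate projections `P_i`, `Q_l` on the same space. Since
`T⋆ T = ∑ A i = ∑ B l = S⋆ S`, a unitary `U` carries `T` to `S`, and then `B l = T⋆ (U⋆ Q_l U) T`;
by freeness no compatibility between the `P_i` and the `U⋆ Q_l U` is needed. -/
theorem exists_dilation {q : ℕ} [NeZero q] (A : ZMod k → Matrix (Fin q) (Fin q) ℂ)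
    (B : ZMod 2 → Matrix (Fin q) (Fin q) ℂ) (hA : ∀ i, (A i).PosSemidef)
    (hB : ∀ l, (B l).PosSemidef) (hAB : ∑ i, A i = ∑ l, B l) :
    ∃ (ρ : GroupCStar (PrismGroup k) →⋆ₐ[ℂ]
        Matrix (ZMod k × ZMod 2 × Fin q) (ZMod k × ZMod 2 × Fin q) ℂ)
      (T : Matrix (ZMod k × ZMod 2 × Fin q) (Fin q) ℂ),
      (∀ i, Tᴴ * ρ (spectralProj (prismInl k) i) * T = A i) ∧
      ∀ l, Tᴴ * ρ (spectralProj (prismInr k) l) * T = B l := by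
  choose C hC using fun i => (hA i).exists_conjTranspose_mul_self
  choose D hD using fun l => (hB l).exists_conjTranspose_mul_self
  -- `T` stacks the `C i` in the slots `(i, 0)`, and `S` stacks the `D l` in the slots `(0, l)`.
  let T : Matrix (ZMod k × ZMod 2 × Fin q) (Fin q) ℂ :=
    Matrix.of fun a y => if a.2.1 = 0 then C a.1 a.2.2 y else 0
  let S : Matrix (ZMod k × ZMod 2 × Fin q) (Fin q) ℂ :=
    Matrix.of fun a y => if a.1 = 0 then D a.2.1 a.2.2 y else 0
  have hT : ∀ i, Tᴴ * diagonal (fun a : ZMod k × ZMod 2 × Fin q => if a.1 = i then (1 : ℂ) else 0)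
      * T = A i := by
    intro i
    rw [hC]
    ext x y
    rw [Matrix.mul_apply]
    simp only [mul_diagonal, Fintype.sum_prod_type]
    simp [Matrix.mul_apply, T]
  have hS : ∀ l, Sᴴ * diagonal (fun a : ZMod k × ZMod 2 × Fin q => if a.2.1 = l then (1 : ℂ) else 0)
      * S = B l := by
    intro l
    rw [hD]
    ext x y
    rw [Matrix.mul_apply]
    simp only [mul_diagonal, Fintype.sum_prod_type]
    simp [Matrix.mul_apply, S]
  have hTS : Tᴴ * T = Sᴴ * S := by
    have hTA : Tᴴ * T = ∑ i, A i := by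
      ext x y
      simp [hC, Matrix.mul_apply, Matrix.sum_apply, Fintype.sum_prod_type, T]
    have hSB : Sᴴ * S = ∑ l, B l := by
      ext x y
      simp [hD, Matrix.mul_apply, Matrix.sum_apply, Fintype.sum_prod_type, S]
    rw [hTA, hSB, hAB]
  obtain ⟨U, hU, hUT⟩ := Matrix.exists_unitary_mul_eq T S hTS
  refine ⟨prismRep k (fun a : ZMod k × ZMod 2 × Fin q => a.1) (fun a => a.2.1) ⟨U, hU⟩, T,
    fun i => ?_, fun l => ?_⟩
  · rw [prismRep_spectralProj_inl, hT]
  · rw [prismRep_spectralProj_inr, ← Matrix.mul_assoc, ← Matrix.mul_assoc, ← conjTranspose_mul,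
      Matrix.mul_assoc _ _ T, hUT, hS]

/-- Positivity on the spectral projections implies complete positivity on `NCP(k)`. -/
theorem mem_cone_of_posSemidef {q : ℕ} (F : Matrix (Fin q) (Fin q) (OpDual (ncPrism k).Elem))
    (hP : ∀ i, (F.map fun f => f (prismP k i)).PosSemidef)
    (hQ : ∀ l, (F.map fun f => f (prismQ k l)).PosSemidef) : F ∈ MatrixCones.cone q := by
  rcases eq_or_ne q 0 with rfl | hq
  · -- The representation space of the dilation would be zero here.
    intro m X _
    exact Subsingleton.elim 0 (Matrix.of fun r s : Fin m × Fin 0 => F r.2 s.2 (X r.1 s.1)) ▸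
      PosSemidef.zero
  have : NeZero q := ⟨hq⟩
  obtain ⟨ρ, T, hρP, hρQ⟩ := exists_dilation _ _ hP hQ (by
    ext x y
    simp only [Matrix.sum_apply]
    exact sum_apply_prismP_eq k (F x y))
  let G (x y : Fin q) : (ncPrism k).Elem →ₗ[ℂ] ℂ :=
    { toFun := fun e => (Tᴴ * ρ (e : GroupCStar (PrismGroup k)) * T) x y
      map_add' := fun e e' => by
        rw [Submodule.coe_add, map_add, Matrix.mul_add, Matrix.add_mul, Matrix.add_apply]
      map_smul' := fun c e => by
        rw [Submodule.coe_smul, map_smul, Matrix.mul_smul, Matrix.smul_mul, Matrix.smul_apply]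
        rfl }
  refine mem_cone_opDual_of_compression ρ T F fun x y e => ?_
  refine LinearMap.congr_fun (f := F x y) (g := G x y) ?_ e
  exact ncPrism_hom_ext (fun i => (congrFun (congrFun (hρP i) x) y).symm)
    fun l => (congrFun (congrFun (hρQ l) x) y).symm

end

/-! ### The complete order isomorphism -/

section
variable (k : ℕ) [NeZero k]

/-- The `k + 2` spectral projections, first those of `w` and then those of `v`. -/
def prismProj (t : Fin (k + 2)) : (ncPrism k).Elem :=
  Fin.append (fun i : Fin k => prismP k (ZMod.finEquiv k i))
    (fun l : Fin 2 => prismQ k (ZMod.finEquiv 2 l)) t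

variable {k}

theorem forall_prismProj {p : (ncPrism k).Elem → Prop} :
    (∀ t, p (prismProj k t)) ↔ (∀ i, p (prismP k i)) ∧ ∀ l, p (prismQ k l) := by
  constructor
  · refine fun h => ⟨fun i => ?_, fun l => ?_⟩
    · simpa [prismProj] using h (Fin.castAdd 2 ((ZMod.finEquiv k).symm i))
    · simpa [prismProj] using h (Fin.natAdd k ((ZMod.finEquiv 2).symm l))
  · rintro ⟨hP, hQ⟩ t
    refine Fin.addCases (fun i => ?_) (fun l => ?_) t
    · simpa [prismProj] using hP _
    · simpa [prismProj] using hQ _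

theorem star_prismProj (t : Fin (k + 2)) : star (prismProj k t) = prismProj k t :=
  forall_prismProj (p := fun x : (ncPrism k).Elem => star x = x).2 ⟨star_prismP k, star_prismQ k⟩ t

theorem prismProj_mem_cone (t : Fin (k + 2)) :
    Matrix.of (fun _ _ : Fin 1 => prismProj k t) ∈ MatrixCones.cone 1 :=
  forall_prismProj (p := fun x => Matrix.of (fun _ _ : Fin 1 => x) ∈ MatrixCones.cone 1).2
    ⟨prismP_mem_cone k, prismQ_mem_cone k⟩ t

theorem mem_cone_opDual_iff {q : ℕ} (F : Matrix (Fin q) (Fin q) (OpDual (ncPrism k).Elem)) :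
    F ∈ MatrixCones.cone q ↔ ∀ t, (F.map fun f => f (prismProj k t)).PosSemidef := by
  constructor
  · intro hF t
    exact (hF 1 _ (prismProj_mem_cone t)).submatrix fun x => ((0 : Fin 1), x)
  · intro h
    obtain ⟨hP, hQ⟩ := forall_prismProj (p := fun x => (F.map fun f => f x).PosSemidef).1 h
    exact mem_cone_of_posSemidef F hP hQ

theorem mem_cone_sumSystem_iff {k n : ℕ} (X : Matrix (Fin n) (Fin n) (sumSystem k).Elem) :
    X ∈ MatrixCones.cone n ↔
      ∀ t, (X.map fun z => (z : Fin (k + 2) → ℂ) t).PosSemidef := by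
  constructor
  · rintro ⟨Y, hY⟩ t
    convert posSemidef_conjTranspose_mul_self (Y.map fun z => z t)
    ext i j
    simpa [Matrix.mul_apply] using congrFun (congrFun (congrFun hY i) j) t
  · intro h
    choose C hC using fun t => (h t).exists_conjTranspose_mul_self
    refine ⟨Matrix.of fun i j t => C t i j, ?_⟩
    ext i j t
    simpa [Matrix.mul_apply] using congrFun (congrFun (hC t) i) j

variable (k)

/-- The evaluation `f ↦ (f(p_1), …, f(p_k), f(q_1), f(q_2))`. -/
def prismDualToSum : OpDual (ncPrism k).Elem →ₗ[ℂ] (sumSystem k).Elem where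
  toFun f := ⟨fun t => f (prismProj k t), by
    change ∑ j : Fin k, f (prismProj k (Fin.castAdd 2 j)) =
      ∑ l : Fin 2, f (prismProj k (Fin.natAdd k l))
    simp only [prismProj, Fin.append_left, Fin.append_right]
    rw [(ZMod.finEquiv k).bijective.sum_comp (fun i => f (prismP k i)),
      (ZMod.finEquiv 2).bijective.sum_comp (fun l => f (prismQ k l))]
    exact sum_apply_prismP_eq k f⟩
  map_add' _ _ := rfl
  map_smul' _ _ := rfl

theorem prismDualToSum_bijective : Function.Bijective (prismDualToSum k) := by
  constructor
  · intro f g hfg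
    obtain ⟨hP, hQ⟩ := forall_prismProj (p := fun x => f x = g x).1
      fun t => congrFun (congrArg Subtype.val hfg) t
    exact ncPrism_hom_ext (f := f) (g := g) hP hQ
  · rintro ⟨z, hz⟩
    change ∑ j : Fin k, z (Fin.castAdd 2 j) = ∑ l : Fin 2, z (Fin.natAdd k l) at hz
    obtain ⟨c, hP, hQ⟩ := exists_abelianFunctional k
      (fun i => z (Fin.castAdd 2 ((ZMod.finEquiv k).symm i)))
      (fun l => z (Fin.natAdd k ((ZMod.finEquiv 2).symm l))) (by
        rw [(ZMod.finEquiv k).symm.bijective.sum_comp (fun i => z (Fin.castAdd 2 i)),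
          (ZMod.finEquiv 2).symm.bijective.sum_comp (fun l => z (Fin.natAdd k l)), hz])
    refine ⟨OpDual.ofFunctional (abelianFunctional k c), Subtype.ext (funext fun t => ?_)⟩
    change abelianFunctional k c (prismProj k t) = z t
    refine Fin.addCases (fun i => ?_) (fun l => ?_) t
    · simp [prismProj, hP]
    · simp [prismProj, hQ]

/-- The evaluation at the spectral projections, as the isomorphism `NCP(k)^δ ≃ S_{k,2}`. -/
def prismDualEquiv : OpDual (ncPrism k).Elem ≃ₗ[ℂ] (sumSystem k).Elem :=
  LinearEquiv.ofBijective (prismDualToSum k) (prismDualToSum_bijective k)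

theorem prismDualEquiv_apply (f : OpDual (ncPrism k).Elem) (t : Fin (k + 2)) :
    (prismDualEquiv k f : Fin (k + 2) → ℂ) t = f (prismProj k t) := rfl

theorem isCompleteOrderIso_prismDualEquiv : IsCompleteOrderIso (prismDualEquiv k) := by
  intro n X
  rw [mem_cone_opDual_iff, mem_cone_sumSystem_iff]
  rfl

theorem prismProj_pos {μ : (ncPrism k).Elem →ₗ[ℂ] ℂ} (hμ : IsFaithfulState (ncPrismOne k) μ)
    (t : Fin (k + 2)) : 0 < μ (prismProj k t) :=
  forall_prismProj (p := fun x => 0 < μ x).2 ⟨hμ.pos_prismP, hμ.pos_prismQ⟩ t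

theorem isOperatorSystem_opDual {μ : (ncPrism k).Elem →ₗ[ℂ] ℂ}
    (hμ : IsFaithfulState (ncPrismOne k) μ) : IsOperatorSystem (OpDual.ofFunctional μ) := by
  refine isOperatorSystem_of_coordinates
    (fun t => { toFun := fun f : OpDual (ncPrism k).Elem => f (prismProj k t)
                map_add' := fun _ _ => rfl
                map_smul' := fun _ _ => rfl })
    (fun t f => ?_) (fun f hf => ?_) (fun n X => mem_cone_opDual_iff X) _ (prismProj_pos k hμ)
  · change star (f (star (prismProj k t))) = star (f (prismProj k t))
    rw [star_prismProj]
  · exact (prismDualToSum_bijective k).1 (Subtype.ext (funext hf))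

theorem isOperatorSystem_sumSystem {μ : (ncPrism k).Elem →ₗ[ℂ] ℂ}
    (hμ : IsFaithfulState (ncPrismOne k) μ) :
    IsOperatorSystem (prismDualEquiv k (OpDual.ofFunctional μ)) := by
  refine isOperatorSystem_of_coordinates
    (fun t => { toFun := fun z : (sumSystem k).Elem => (z : Fin (k + 2) → ℂ) t
                map_add' := fun _ _ => rfl
                map_smul' := fun _ _ => rfl })
    (fun _ _ => rfl) (fun z hz => Subtype.ext (funext hz))
    (fun n X => mem_cone_sumSystem_iff X) _ (prismProj_pos k hμ)

end

end

theorem mainTheorem6 (k : ℕ) (hk : 3 ≤ k) :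
    ∃ Φ : OpDual (ncPrism k).Elem ≃ₗ[ℂ] (sumSystem k).Elem,
      IsCompleteOrderIso Φ ∧
      (∀ μ : (ncPrism k).Elem →ₗ[ℂ] ℂ, IsFaithfulState (ncPrismOne k) μ →
        IsOperatorSystem (OpDual.ofFunctional μ) ∧
        IsOperatorSystem (Φ (OpDual.ofFunctional μ))) ∧
      ∃ τ : (ncPrism k).Elem →ₗ[ℂ] ℂ, IsFaithfulState (ncPrismOne k) τ ∧
        (∀ j : Fin k, (j : ℕ) ≠ 0 → τ (ncPrismW k j) = 0) ∧
        τ (ncPrismV k) = 0 ∧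
        ((Φ (OpDual.ofFunctional τ) : (sumSystem k).Elem) : Fin (k + 2) → ℂ) =
          Fin.append (fun _ : Fin k => 1 / (k : ℂ)) (fun _ : Fin 2 => 1 / 2) := by
  have : NeZero k := ⟨by omega⟩
  refine ⟨prismDualEquiv k, isCompleteOrderIso_prismDualEquiv k,
    fun μ hμ => ⟨isOperatorSystem_opDual k hμ, isOperatorSystem_sumSystem k hμ⟩,
    prismTrace k, isFaithfulState_prismTrace k, prismTrace_ncPrismW k, prismTrace_ncPrismV k, ?_⟩
  funext t
  change prismTrace k (prismProj k t) = _
  refine Fin.addCases (fun i => ?_) (fun l => ?_) t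
  · simp only [prismProj, Fin.append_left, prismTrace_prismP]
  · simp only [prismProj, Fin.append_right, prismTrace_prismQ]
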